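/- **Theorem (Stochastic Homomorphic Policy Gradient).** A continuous MDP $\mathcal M=(\mathcal S,\mathcal A,\tau,R,\gamma)$ consists of measurable spaces $\mathcal S,\mathcal A$, a transition probability kernel $\tau_a(\cdot\mid s)$ from $\mathcal S\times\mathcal A$ to $\mathcal S$, a measurable reward $R:\mathcal S\times\mathcal A\to\mathbb R$ and a discount factor $\gamma\in(0,1]$. For a policy $\pi$ (a probability kernel from $\mathcal S$ to $\mathcal A$), let $Q^\pi(s,a)$ be the expected value of $\sum_{t\ge0}\gamma^tR(s_t,a_t)$ when $s_0=s$, $a_0=a$ and $\pi$ is followed thereafter, and $V^\pi(s)$ the same expectation when $s_0=s$ and $\pi$ is followed from time $0$. Let $h=(f,(g_s)_{s\in\mathcal S})$ be a continuous MDP homomorphism from $\mathcal M$ to $\overline{\mathcal M}=(\overline{\mathcal S},\overline{\mathcal A},\overline\tau,\overline R,\overline\gamma)$: the maps $f:\mathcal S\to\overline{\mathcal S}$ and $g_s:\mathcal A\to\overline{\mathcal A}$ are measurable and surjective, $\overline R(f(s),g_s(a))=R(s,a)$, $\overline\tau_{g_s(a)}(\overline B\mid f(s))=\tau_a(f^{-1}(\overline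 B)\mid s)$ for all $s,a$ and measurable $\overline B$, and $\overline\gamma=\gamma$. Assume $\gamma<1$ and $\sup_{s,a}|R(s,a)|<\infty$. Let $U\subseteq\mathbb R^n$ be open and let $\overline\pi_\theta$ ($\theta\in U$) be stochastic policies on $\overline{\mathcal M}$ such that * for all $\theta\in U$ and $\overline s\in\overline{\mathcal S}$ there is an $\mathbb R^n$-valued vector measure $\nabla_\theta\overline\pi_\theta(d\overline a\mid\overline s)$ on $\overline{\mathcal A}$ whose value on each measurable set $B$ is the gradient of $\theta\mapsto\overline\pi_\theta(B\mid\overline s)$ at $\theta$; * this gradient is bounded, locally uniformly in $\theta$: every $\theta\in U$ has a neighbourhood on which $\|\nabla_\theta\overline\pi_\theta(B\mid\overline s)\|\le L$ for all $\overline s$ and $B$, with a constant $L$ (depending on the neighbourhood). For $\theta\in U$ let $\pi^\uparrow_\theta$ be any lifted policy of $\overline\pi_\theta$, that is, a policy on $\mathcal M$ with $\pi^\uparrow_\theta(g_s^{-1}(\beta)\mid s)=\overline\pi_\theta(\beta\mid f(s))$ for all $s$ and all measurable $\beta\subseteq\overline{\mathcal A}$. Let $p_1$ be a probability measure on $\mathcal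 S$ (the initial state distribution), and let $J(\theta)=\int_{\mathcal S}V^{\pi^\uparrow_\theta}(s)\,p_1(ds)$ be the performance of $\pi^\uparrow_\theta$ on the actual MDP $\mathcal M$. Then $J$ is differentiable at every $\theta\in U$, and $$ \nabla_\theta J(\theta)=\int_{\overline{\mathcal S}}\Big(\int_{\overline{\mathcal A}}\overline Q^{\overline\pi_\theta}(\overline s,\overline a)\,\nabla_\theta\overline\pi_\theta(d\overline a\mid\overline s)\Big)\rho^{\overline\pi_\theta}(d\overline s), $$ where both integrals converge absolutely, $\overline Q^{\overline\pi_\theta}$ is the action-value function of $\overline\pi_\theta$ on $\overline{\mathcal M}$, and $\rho^{\overline\pi_\theta}(B)=\sum_{t=0}^\infty\gamma^t\,\mathbb P(\overline s_t\in B)$ is the (unnormalized) discounted state distribution of $\overline{\mathcal M}$ when $\overline\pi_\theta$ is followed from the initial distribution $f_*p_1$. -/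

import Mathlib

open MeasureTheory ProbabilityTheory Topology

noncomputable section

/-- A continuous Markov decision process on measurable spaces of states `S` and actions `A`:
a transition probability kernel, a reward function and a discount factor. The topology of the
action space and the smoothness of `a ↦ τ_a(B | s)` are not part of the structure: what is proved
about it holds in particular for the processes that have them. -/
structure ContinuousMDP (S A : Type*) [MeasurableSpace S] [MeasurableSpace A] where
  /-- `τ (s, a)` is the law `τ_a(· | s)` of the next state. -/
  τ : Kernel (S × A) S
  isMarkovKernel_τ : IsMarkovKernel τ
  /-- The reward `R s a`. -/
  R : S → A → ℝ
  measurable_R : Measurable (Function.uncurry R)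
  /-- The discount factor. -/
  γ : ℝ
  γ_pos : 0 < γ
  γ_le_one : γ ≤ 1

namespace ContinuousMDP

variable {S A : Type*} [MeasurableSpace S] [MeasurableSpace A]

instance (M : ContinuousMDP S A) : IsMarkovKernel M.τ := M.isMarkovKernel_τ

/-- One step of the state-action process: `s' ∼ τ_a(· | s)`, then `a' ∼ π(· | s')`. -/
def step (M : ContinuousMDP S A) (π : Kernel S A) : Kernel (S × A) (S × A) :=
  M.τ.compProd (Kernel.prodMkLeft (S × A) π)

instance (M : ContinuousMDP S A) (π : Kernel S A) [IsMarkovKernel π] :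
    IsMarkovKernel (M.step π) := by
  unfold step; infer_instance

/-- The law of `(s_{t+1}, a_{t+1})` given the history `(s_0, a_0), …, (s_t, a_t)`. -/
def historyKernel (M : ContinuousMDP S A) (π : Kernel S A) (t : ℕ) :
    Kernel (Finset.Iic t → S × A) (S × A) :=
  (M.step π).comap (fun x => x ⟨t, Finset.mem_Iic.2 le_rfl⟩) (measurable_pi_apply _)

instance (M : ContinuousMDP S A) (π : Kernel S A) [IsMarkovKernel π] (t : ℕ) :
    IsMarkovKernel (M.historyKernel π t) := by
  unfold historyKernel; infer_instance

/-- The law of the trajectory `((s_t, a_t))_{t ∈ ℕ}` when `(s_0, a_0) ∼ μ₀` and the policy `π`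
is followed from time `1` on. -/
def trajectoryLaw (M : ContinuousMDP S A) (π : Kernel S A) [IsMarkovKernel π]
    (μ₀ : Measure (S × A)) : Measure (ℕ → S × A) :=
  Kernel.trajMeasure (X := fun _ => S × A) μ₀ (M.historyKernel π)

/-- The discounted return `∑ₜ γ^t R(s_t, a_t)` of a trajectory. -/
def discountedReturn (M : ContinuousMDP S A) (ω : ℕ → S × A) : ℝ :=
  ∑' t, M.γ ^ t * M.R (ω t).1 (ω t).2

/-- The action-value function `Q^π(s, a)`: the expected return when starting from the state `s`,
taking the action `a` and following `π` thereafter. -/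
def actionValue (M : ContinuousMDP S A) (π : Kernel S A) [IsMarkovKernel π] (s : S) (a : A) : ℝ :=
  ∫ ω, M.discountedReturn ω ∂(M.trajectoryLaw π (Measure.dirac (s, a)))

/-- The value function `V^π(s)`: the expected return when starting from the state `s` and
following `π`. -/
def value (M : ContinuousMDP S A) (π : Kernel S A) [IsMarkovKernel π] (s : S) : ℝ :=
  ∫ ω, M.discountedReturn ω ∂(M.trajectoryLaw π ((Measure.dirac s).compProd π))

/-- The performance measure `𝔼_{s ∼ p₁}[V^π(s)]`, where `p₁` is the initial state distribution. -/
def performance (M : ContinuousMDP S A) (p₁ : Measure S) (π : Kernel S A) [IsMarkovKernel π] : ℝ :=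
  ∫ s, M.value π s ∂p₁

/-- The (unnormalized) discounted state distribution
`ρ^π(B) = ∑ₜ γ^t ℙ(s_t ∈ B | s_0 ∼ p₁, following π)`. -/
def discountedStateDistribution (M : ContinuousMDP S A) (p₁ : Measure S) (π : Kernel S A)
    [IsMarkovKernel π] : Measure S :=
  Measure.sum fun t : ℕ =>
    ENNReal.ofReal (M.γ ^ t) • (M.trajectoryLaw π (p₁.compProd π)).map (fun ω => (ω t).1)

end ContinuousMDP

/-- A continuous MDP homomorphism `h = (f, g_s)` from `M` onto its image `N`. -/
structure ContinuousMDPHom {S A S' A' : Type*} [MeasurableSpace S] [MeasurableSpace A]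
    [MeasurableSpace S'] [MeasurableSpace A']
    (M : ContinuousMDP S A) (N : ContinuousMDP S' A') where
  f : S → S'
  g : S → A → A'
  measurable_f : Measurable f
  surjective_f : Function.Surjective f
  measurable_g : ∀ s, Measurable (g s)
  surjective_g : ∀ s, Function.Surjective (g s)
  /-- Invariance of reward. -/
  reward_eq : ∀ s a, N.R (f s) (g s a) = M.R s a
  /-- Equivariance of transitions. -/
  transition_eq : ∀ s a (B : Set S'), MeasurableSet B →
    N.τ (f s, g s a) B = M.τ (s, a) (f ⁻¹' B)
  /-- The two processes have the same discount factor. -/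
  discount_eq : N.γ = M.γ

/-- `πup` is a lifted policy of the abstract policy `πbar`:
`πup(g_s⁻¹(β) | s) = πbar(β | f(s))`. -/
def ContinuousMDPHom.IsLift {S A S' A' : Type*} [MeasurableSpace S] [MeasurableSpace A]
    [MeasurableSpace S'] [MeasurableSpace A']
    {M : ContinuousMDP S A} {N : ContinuousMDP S' A'} (h : ContinuousMDPHom M N)
    (πup : Kernel S A) (πbar : Kernel S' A') : Prop :=
  ∀ s (β : Set A'), MeasurableSet β → πup s (h.g s ⁻¹' β) = πbar (h.f s) β

section PolicyGradient

variable {S A Θ : Type*} [MeasurableSpace S] [MeasurableSpace A]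
  [NormedAddCommGroup Θ] [InnerProductSpace ℝ Θ] [CompleteSpace Θ]

/-- The `Θ`-valued vector measure `D` on the actions is the gradient at `θ` of
`θ ↦ π_θ(· | s)`: for every event `B`, `D B = ∇_θ π_θ(B | s)`. -/
def IsPolicyGradientAt (π : Θ → Kernel S A) (θ : Θ) (s : S) (D : VectorMeasure A Θ) : Prop :=
  ∀ B, MeasurableSet B → HasGradientAt (fun ϑ => (π ϑ s).real B) (D B) θ

/-- The parametrized policy is differentiable at `θ`: for every state `s` the law `π_θ(· | s)` has
a gradient with respect to `θ`, which is a vector measure. -/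
def PolicyDifferentiableAt (π : Θ → Kernel S A) (θ : Θ) : Prop :=
  ∀ s, ∃ D : VectorMeasure A Θ, IsPolicyGradientAt π θ s D

open scoped Classical in
/-- The gradient `∇_θ π_θ(da | s)`, a vector measure on the actions with values in the parameter
space (`0` if there is no such gradient). -/
def policyGradient (π : Θ → Kernel S A) (θ : Θ) (s : S) : VectorMeasure A Θ :=
  if h : ∃ D : VectorMeasure A Θ, IsPolicyGradientAt π θ s D then h.choose else 0

/-- The gradient is the one and only vector measure with the defining property. -/
theorem IsPolicyGradientAt.policyGradient_eq {π : Θ → Kernel S A} {θ : Θ} {s : S}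
    {D : VectorMeasure A Θ} (hD : IsPolicyGradientAt π θ s D) : policyGradient π θ s = D := by
  have h : ∃ D : VectorMeasure A Θ, IsPolicyGradientAt π θ s D := ⟨D, hD⟩
  have h' : IsPolicyGradientAt π θ s (policyGradient π θ s) := by
    rw [policyGradient, dif_pos h]; exact h.choose_spec
  exact VectorMeasure.ext fun B hB => (h' B hB).unique (hD B hB)

end PolicyGradient

end

/-! A lifted policy and its abstract policy have the same values along `f`: the difference of the
two value functions is a bounded fixed point of a reward-free Bellman operator that contracts by
`γ`, so it vanishes (`IsLift.value_eq`). The claim thus reduces to the policy gradient theorem on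
the image MDP, started from `f_*p₁`.

That theorem rests on `performance_sub_performance`: J(π') - J(π) = ∫ (∫ Q^{π'} d(π' - π)) dρ^π.
With π = π_θ and π' = π_ϑ, replace Q^{π'} by Q^π. The error is an integral of Q^{π'} - Q^π against
π' - π; both factors are O(‖ϑ - θ‖), uniformly in the state, so the error is quadratic and has zero
derivative. No derivative of Q is ever taken.

What remains is to differentiate ∫∫ Q^{π_θ} dπ_ϑ dρ with Q and ρ frozen. The inner derivative comes
from gradients on events by uniform approximation with simple functions
(`hasGradientAt_integral_of_bounded`); the outer one is dominated differentiation against the finite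
measure ρ (`hasGradientAt_integral_of_lip`). -/

namespace ContinuousMDP

variable {S A : Type*} [MeasurableSpace S] [MeasurableSpace A]

/-! ### Trajectory laws and their one-time marginals -/

/-- The law of the trajectory as a kernel from the initial state-action pair. -/
noncomputable def trajectoryKernel (M : ContinuousMDP S A) (π : Kernel S A) [IsMarkovKernel π] :
    Kernel (S × A) (ℕ → S × A) :=
  (Kernel.traj (X := fun _ => S × A) (M.historyKernel π) 0).comap
    (MeasurableEquiv.piUnique (fun _ : Finset.Iic 0 => S × A)).symm (by fun_prop)

instance (M : ContinuousMDP S A) (π : Kernel S A) [IsMarkovKernel π] :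
    IsMarkovKernel (M.trajectoryKernel π) := by
  unfold trajectoryKernel; infer_instance

theorem trajectoryLaw_eq_comp (M : ContinuousMDP S A) (π : Kernel S A) [IsMarkovKernel π]
    (μ : Measure (S × A)) : M.trajectoryLaw π μ = M.trajectoryKernel π ∘ₘ μ := by
  rw [trajectoryLaw, Kernel.trajMeasure, trajectoryKernel]
  ext s hs
  rw [Measure.bind_apply hs (by fun_prop), Measure.bind_apply hs (by fun_prop)]
  erw [lintegral_map (Kernel.measurable_coe _ hs) (by fun_prop)]
  rfl

instance (M : ContinuousMDP S A) (π : Kernel S A) [IsMarkovKernel π]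
    (μ : Measure (S × A)) [IsProbabilityMeasure μ] : IsProbabilityMeasure (M.trajectoryLaw π μ) := by
  rw [trajectoryLaw_eq_comp]; infer_instance

theorem trajectoryLaw_dirac (M : ContinuousMDP S A) (π : Kernel S A) [IsMarkovKernel π]
    (p : S × A) : M.trajectoryLaw π (Measure.dirac p) = M.trajectoryKernel π p := by
  rw [trajectoryLaw_eq_comp, Measure.dirac_bind (Kernel.measurable _)]

/-- The law of `(s_t, a_t)` given `(s_0, a_0)`. -/
noncomputable def stepIter (M : ContinuousMDP S A) (π : Kernel S A) : ℕ → Kernel (S × A) (S × A)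
  | 0 => Kernel.id
  | t + 1 => M.step π ∘ₖ stepIter M π t

instance (M : ContinuousMDP S A) (π : Kernel S A) [IsMarkovKernel π] (t : ℕ) :
    IsMarkovKernel (M.stepIter π t) := by
  induction t with
  | zero => unfold stepIter; infer_instance
  | succ t ih => unfold stepIter; infer_instance

/-- The recursion appends steps at the end; the Bellman equation needs the first step split off
instead. -/
theorem stepIter_succ' (M : ContinuousMDP S A) (π : Kernel S A) (t : ℕ) :
    M.stepIter π (t + 1) = M.stepIter π t ∘ₖ M.step π := by
  induction t with
  | zero => simp [stepIter]
  | succ t ih => rw [stepIter, ih, ← Kernel.comp_assoc, ← ih]; rfl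

/-- The history kernel sees only the last state-action pair, so one-time marginals evolve by `step`
alone. -/
theorem map_eval_trajectoryLaw (M : ContinuousMDP S A) (π : Kernel S A) [IsMarkovKernel π]
    (μ : Measure (S × A)) [IsProbabilityMeasure μ] (t : ℕ) :
    (M.trajectoryLaw π μ).map (fun ω => ω t) = M.stepIter π t ∘ₘ μ := by
  induction t with
  | zero =>
    rw [trajectoryLaw, Kernel.trajMeasure, Measure.map_comp _ _ (by fun_prop)]
    have h : (Kernel.traj (X := fun _ => S × A) (M.historyKernel π) 0).map (fun ω => ω 0)
        = Kernel.deterministic (fun x : Finset.Iic 0 → S × A => x ⟨0, by simp⟩) (by fun_prop) := by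
      have h1 := Kernel.traj_map_frestrictLe_of_le (κ := M.historyKernel π)
        (X := fun _ => S × A) (le_refl 0)
      have h2 : (fun ω : ℕ → S × A => ω 0) =
        (fun x : Finset.Iic 0 → S × A => x ⟨0, by simp⟩) ∘ (Preorder.frestrictLe 0) := rfl
      rw [h2, Kernel.map_comp_right _ (Preorder.measurable_frestrictLe (X := fun _ => S × A) 0)
        (by fun_prop)]
      erw [h1]
      rw [Kernel.deterministic_map _ (by fun_prop)]
      rfl
    rw [h, Measure.deterministic_comp_eq_map]
    erw [Measure.map_map (by fun_prop) (by fun_prop)]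
    simp only [stepIter, Measure.id_comp]
    exact Measure.map_id
  | succ t ih =>
    have h := Kernel.map_frestrictLe_trajMeasure_compProd_eq_map_trajMeasure
      (X := fun _ => S × A) (μ₀ := μ) (κ := M.historyKernel π) (a := t)
    have h' := congrArg Measure.snd h
    rw [Measure.snd_compProd, Measure.snd, Measure.map_map (by fun_prop) (by fun_prop)] at h'
    have h3 : (M.trajectoryLaw π μ).map (fun ω => ω (t + 1)) =
      M.historyKernel π t ∘ₘ ((M.trajectoryLaw π μ).map (Preorder.frestrictLe t)) := h'.symm
    rw [h3, stepIter, ← Measure.comp_assoc, ← ih]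
    ext s hs
    rw [Measure.bind_apply hs (by fun_prop), Measure.bind_apply hs (by fun_prop),
      lintegral_map (Kernel.measurable_coe _ hs) (by fun_prop),
      lintegral_map (Kernel.measurable_coe _ hs) (by fun_prop)]
    rfl

end ContinuousMDP

/-! ### Integrals of bounded functions -/

theorem MeasureTheory.integrable_of_measurable_of_abs_le {X : Type*} [MeasurableSpace X]
    {μ : Measure X} [IsFiniteMeasure μ] {f : X → ℝ} (hf : Measurable f) {C : ℝ}
    (hC : ∀ x, |f x| ≤ C) : Integrable f μ :=
  Integrable.of_bound hf.aestronglyMeasurable C (ae_of_all _ hC)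

theorem MeasureTheory.abs_integral_le_of_abs_le {X : Type*} [MeasurableSpace X]
    {μ : Measure X} [IsProbabilityMeasure μ] {f : X → ℝ} {C : ℝ}
    (hC : ∀ x, |f x| ≤ C) : |∫ x, f x ∂μ| ≤ C := by
  simpa using norm_integral_le_of_norm_le_const (μ := μ) (f := f) (ae_of_all _ hC)

theorem MeasureTheory.Measure.integral_comp_kernel {X Y : Type*} [MeasurableSpace X]
    [MeasurableSpace Y] {κ : Kernel X Y} {μ : Measure X} {f : Y → ℝ}
    (hf : Integrable f (κ ∘ₘ μ)) : ∫ y, f y ∂(κ ∘ₘ μ) = ∫ x, ∫ y, f y ∂κ x ∂μ := by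
  rw [Measure.comp_eq_comp_const_apply] at hf ⊢
  rw [Kernel.integral_comp hf, Kernel.const_apply]

/-! ### Value functions and the Bellman equation -/

namespace ContinuousMDP

variable {S A : Type*} [MeasurableSpace S] [MeasurableSpace A]

section Bounds

variable (M : ContinuousMDP S A) {b : ℝ}

theorem abs_discounted_reward_le (hb : ∀ s a, |M.R s a| ≤ b) (t : ℕ) (p : S × A) :
    |M.γ ^ t * M.R p.1 p.2| ≤ M.γ ^ t * b := by
  rw [abs_mul, abs_of_nonneg (pow_nonneg M.γ_pos.le t)]
  exact mul_le_mul_of_nonneg_left (hb _ _) (pow_nonneg M.γ_pos.le t)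

theorem summable_discounted (hγ : M.γ < 1) (b : ℝ) : Summable fun t : ℕ => M.γ ^ t * b :=
  (summable_geometric_of_lt_one M.γ_pos.le hγ).mul_right b

theorem measurable_reward_comp {X : Type*} [MeasurableSpace X] {φ : X → S × A}
    (hφ : Measurable φ) : Measurable fun x => M.R (φ x).1 (φ x).2 :=
  M.measurable_R.comp hφ

theorem summable_discounted_reward (hγ : M.γ < 1) (hb : ∀ s a, |M.R s a| ≤ b)
    (ω : ℕ → S × A) : Summable fun t => M.γ ^ t * M.R (ω t).1 (ω t).2 :=
  Summable.of_norm_bounded (M.summable_discounted hγ b)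
    fun t => M.abs_discounted_reward_le hb t (ω t)

theorem measurable_discountedReturn (hγ : M.γ < 1) (hb : ∀ s a, |M.R s a| ≤ b) :
    Measurable M.discountedReturn := by
  refine measurable_of_tendsto_metrizable
    (f := fun n ω => ∑ t ∈ Finset.range n, M.γ ^ t * M.R (ω t).1 (ω t).2) (fun n => ?_) ?_
  · exact Finset.measurable_sum _ fun t _ =>
      (M.measurable_reward_comp (measurable_pi_apply t)).const_mul _
  · rw [tendsto_pi_nhds]
    exact fun ω => (M.summable_discounted_reward hγ hb ω).hasSum.tendsto_sum_nat

theorem abs_discountedReturn_le (hγ : M.γ < 1) (hb : ∀ s a, |M.R s a| ≤ b) (ω : ℕ → S × A) :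
    |M.discountedReturn ω| ≤ (1 - M.γ)⁻¹ * b := by
  have h : HasSum (fun t : ℕ => M.γ ^ t * b) ((1 - M.γ)⁻¹ * b) :=
    (hasSum_geometric_of_lt_one M.γ_pos.le hγ).mul_right b
  exact tsum_of_norm_bounded (f := fun t => M.γ ^ t * M.R (ω t).1 (ω t).2) h
    fun t => M.abs_discounted_reward_le hb t (ω t)

end Bounds

variable (M : ContinuousMDP S A) (π : Kernel S A) [IsMarkovKernel π] {b : ℝ}

theorem actionValue_eq_integral_trajectoryKernel (p : S × A) :
    M.actionValue π p.1 p.2 = ∫ ω, M.discountedReturn ω ∂(M.trajectoryKernel π p) := by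
  rw [actionValue, trajectoryLaw_dirac]

theorem measurable_actionValue (hγ : M.γ < 1) (hb : ∀ s a, |M.R s a| ≤ b) :
    Measurable fun p : S × A => M.actionValue π p.1 p.2 := by
  simp_rw [actionValue_eq_integral_trajectoryKernel]
  exact ((M.measurable_discountedReturn hγ hb).stronglyMeasurable.integral_kernel
    (κ := M.trajectoryKernel π)).measurable

theorem measurable_actionValue_right (hγ : M.γ < 1) (hb : ∀ s a, |M.R s a| ≤ b) (s : S) :
    Measurable (M.actionValue π s) := by
  simpa only [Function.comp_def] using
    (M.measurable_actionValue π hγ hb).comp (measurable_prodMk_left (x := s))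

theorem abs_actionValue_le (hγ : M.γ < 1) (hb : ∀ s a, |M.R s a| ≤ b) (s : S) (a : A) :
    |M.actionValue π s a| ≤ (1 - M.γ)⁻¹ * b :=
  abs_integral_le_of_abs_le (M.abs_discountedReturn_le hγ hb)

theorem integral_discountedReturn (hγ : M.γ < 1) (hb : ∀ s a, |M.R s a| ≤ b)
    (μ : Measure (S × A)) [IsProbabilityMeasure μ] :
    ∫ ω, M.discountedReturn ω ∂(M.trajectoryLaw π μ) = ∫ p, M.actionValue π p.1 p.2 ∂μ := by
  simp_rw [actionValue_eq_integral_trajectoryKernel]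
  rw [trajectoryLaw_eq_comp, Measure.integral_comp_kernel]
  exact integrable_of_measurable_of_abs_le (M.measurable_discountedReturn hγ hb)
    (M.abs_discountedReturn_le hγ hb)

theorem value_eq_integral_actionValue (hγ : M.γ < 1) (hb : ∀ s a, |M.R s a| ≤ b) (s : S) :
    M.value π s = ∫ a, M.actionValue π s a ∂(π s) := by
  rw [value, integral_discountedReturn M π hγ hb, Measure.integral_compProd, integral_dirac']
  · exact ((M.measurable_actionValue π hγ hb).stronglyMeasurable.integral_kernel_prod_right'
      (κ := π))
  · exact integrable_of_measurable_of_abs_le (M.measurable_actionValue π hγ hb)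
      fun p => M.abs_actionValue_le π hγ hb p.1 p.2

theorem measurable_value (hγ : M.γ < 1) (hb : ∀ s a, |M.R s a| ≤ b) :
    Measurable (M.value π) := by
  have : M.value π = fun s => ∫ a, M.actionValue π s a ∂(π s) :=
    funext (M.value_eq_integral_actionValue π hγ hb)
  rw [this]
  exact ((M.measurable_actionValue π hγ hb).stronglyMeasurable.integral_kernel_prod_right'
      (κ := π)).measurable

theorem abs_value_le (hγ : M.γ < 1) (hb : ∀ s a, |M.R s a| ≤ b) (s : S) :
    |M.value π s| ≤ (1 - M.γ)⁻¹ * b :=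
  abs_integral_le_of_abs_le (M.abs_discountedReturn_le hγ hb)

theorem integrable_value (hγ : M.γ < 1) (hb : ∀ s a, |M.R s a| ≤ b) (μ : Measure S)
    [IsFiniteMeasure μ] : Integrable (M.value π) μ :=
  integrable_of_measurable_of_abs_le (M.measurable_value π hγ hb) (M.abs_value_le π hγ hb)

/-- The geometric bound on discounted rewards allows sum and expectation to be exchanged; only the
marginals of the trajectory then matter. -/
theorem hasSum_integral_actionValue (hγ : M.γ < 1) (hb : ∀ s a, |M.R s a| ≤ b)
    (μ : Measure (S × A)) [IsProbabilityMeasure μ] :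
    HasSum (fun t : ℕ => M.γ ^ t * ∫ p, M.R p.1 p.2 ∂(M.stepIter π t ∘ₘ μ))
      (∫ p, M.actionValue π p.1 p.2 ∂μ) := by
  rw [← integral_discountedReturn M π hγ hb]
  have hm (t : ℕ) : Measurable fun ω : ℕ → S × A => M.γ ^ t * M.R (ω t).1 (ω t).2 :=
    (M.measurable_reward_comp (measurable_pi_apply t)).const_mul _
  have hle (t : ℕ) (ω : ℕ → S × A) := M.abs_discounted_reward_le hb t (ω t)
  have h := hasSum_integral_of_summable_integral_norm (μ := M.trajectoryLaw π μ)
    (F := fun (t : ℕ) ω => M.γ ^ t * M.R (ω t).1 (ω t).2)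
    (fun t => integrable_of_measurable_of_abs_le (hm t) (hle t)) ?_
  · convert! h using 2 with t
    rw [integral_const_mul, ← map_eval_trajectoryLaw, integral_map (measurable_pi_apply t).aemeasurable]
    exact (M.measurable_reward_comp measurable_id).aestronglyMeasurable
  · refine Summable.of_nonneg_of_le (fun t => integral_nonneg fun ω => norm_nonneg _)
      (fun t => ?_) (M.summable_discounted hγ b)
    refine (le_abs_self _).trans (abs_integral_le_of_abs_le fun ω => ?_)
    rw [abs_norm]
    exact hle t ω

/-- The Bellman equation for the action-value function. -/
theorem actionValue_eq (hγ : M.γ < 1) (hb : ∀ s a, |M.R s a| ≤ b) (s : S) (a : A) :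
    M.actionValue π s a = M.R s a + M.γ * ∫ s', M.value π s' ∂(M.τ (s, a)) := by
  have h0 := M.hasSum_integral_actionValue π hγ hb (Measure.dirac (s, a))
  have h1 := M.hasSum_integral_actionValue π hγ hb (M.step π (s, a))
  rw [integral_dirac' _ _ (M.measurable_actionValue π hγ hb).stronglyMeasurable] at h0
  have hstep : ∫ p, M.actionValue π p.1 p.2 ∂(M.step π (s, a))
      = ∫ s', M.value π s' ∂(M.τ (s, a)) := by
    rw [step, integral_compProd]
    · simp_rw [value_eq_integral_actionValue M π hγ hb, Kernel.prodMkLeft_apply]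
    · exact integrable_of_measurable_of_abs_le (M.measurable_actionValue π hγ hb)
        fun p => M.abs_actionValue_le π hγ hb p.1 p.2
  rw [hstep] at h1
  -- Without its term at time 0, the series started at `(s, a)` is `γ` times the series started from
  -- `step π (s, a)`.
  have h2 := (hasSum_nat_add_iff' 1).2 h0
  have h3 := h1.mul_left M.γ
  have h4 := h2.unique (by
    convert! h3 using 2 with t
    rw [stepIter_succ', ← Measure.comp_assoc, Measure.dirac_bind (Kernel.measurable _)]
    ring)
  have h5 : ∫ p, M.R p.1 p.2 ∂(Measure.dirac (s, a)) = M.R s a :=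
    integral_dirac' _ _ (M.measurable_reward_comp measurable_id).stronglyMeasurable
  simp [stepIter, h5] at h4
  linarith

end ContinuousMDP

/-! ### Discounted state distribution and performance difference -/

namespace ContinuousMDP

variable {S A : Type*} [MeasurableSpace S] [MeasurableSpace A]
variable (M : ContinuousMDP S A) (π : Kernel S A) [IsMarkovKernel π] {b : ℝ}

/-- The law of `s_t` when `s_0 ∼ p` and `π` is followed. -/
noncomputable def stateLaw (p : Measure S) : ℕ → Measure S
  | 0 => p
  | t + 1 => M.τ ∘ₘ (stateLaw p t ⊗ₘ π)

instance (p : Measure S) [IsProbabilityMeasure p] (t : ℕ) :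
    IsProbabilityMeasure (M.stateLaw π p t) := by
  induction t with
  | zero => assumption
  | succ t ih => unfold stateLaw; infer_instance

theorem step_comp (m : Measure (S × A)) [SFinite m] :
    M.step π ∘ₘ m = (M.τ ∘ₘ m) ⊗ₘ π := by
  ext s hs
  rw [Measure.bind_apply hs (by fun_prop), Measure.compProd_apply hs,
    Measure.lintegral_bind (by fun_prop) (Kernel.measurable_kernel_prodMk_left hs).aemeasurable]
  simp_rw [step, Kernel.compProd_apply hs, Kernel.prodMkLeft_apply]

theorem stepIter_comp_compProd (p : Measure S) [IsProbabilityMeasure p] (t : ℕ) :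
    M.stepIter π t ∘ₘ (p ⊗ₘ π) = M.stateLaw π p t ⊗ₘ π := by
  induction t with
  | zero => simp [stepIter, stateLaw]
  | succ t ih => rw [stepIter, ← Measure.comp_assoc, ih, step_comp, stateLaw]

theorem discountedStateDistribution_eq_sum (p : Measure S) [IsProbabilityMeasure p] :
    M.discountedStateDistribution p π
      = Measure.sum fun t : ℕ => ENNReal.ofReal (M.γ ^ t) • M.stateLaw π p t := by
  rw [discountedStateDistribution]
  congr with t : 1
  have h : (fun ω : ℕ → S × A => (ω t).1) = Prod.fst ∘ fun ω => ω t := rfl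
  rw [h, ← Measure.map_map measurable_fst (measurable_pi_apply t), map_eval_trajectoryLaw,
    stepIter_comp_compProd, ← Measure.fst, Measure.fst_compProd]

theorem isFiniteMeasure_discountedStateDistribution (hγ : M.γ < 1) (p : Measure S)
    [IsProbabilityMeasure p] : IsFiniteMeasure (M.discountedStateDistribution p π) := by
  refine ⟨?_⟩
  rw [discountedStateDistribution_eq_sum, Measure.sum_apply _ .univ]
  simp only [Measure.smul_apply, measure_univ, smul_eq_mul, mul_one]
  rw [← ENNReal.ofReal_tsum_of_nonneg (fun t => pow_nonneg M.γ_pos.le t)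
    (summable_geometric_of_lt_one M.γ_pos.le hγ)]
  exact ENNReal.ofReal_lt_top

theorem hasSum_integral_discountedStateDistribution (hγ : M.γ < 1) (p : Measure S)
    [IsProbabilityMeasure p] {u : S → ℝ} (hu : Measurable u) {C : ℝ} (hC : ∀ s, |u s| ≤ C) :
    HasSum (fun t : ℕ => M.γ ^ t * ∫ s, u s ∂(M.stateLaw π p t))
      (∫ s, u s ∂(M.discountedStateDistribution p π)) := by
  have := M.isFiniteMeasure_discountedStateDistribution π hγ p
  have hi : Integrable u (M.discountedStateDistribution p π) :=
    integrable_of_measurable_of_abs_le hu hC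
  rw [discountedStateDistribution_eq_sum] at hi ⊢
  convert! hasSum_integral_measure hi using 2 with t
  rw [integral_smul_measure, ENNReal.toReal_ofReal (pow_nonneg M.γ_pos.le t), smul_eq_mul]

theorem abs_integral_discountedStateDistribution_le (hγ : M.γ < 1) (p : Measure S)
    [IsProbabilityMeasure p] {u : S → ℝ} (hu : Measurable u) {C : ℝ} (hC : ∀ s, |u s| ≤ C) :
    |∫ s, u s ∂(M.discountedStateDistribution p π)| ≤ (1 - M.γ)⁻¹ * C := by
  have h : HasSum (fun t : ℕ => M.γ ^ t * C) ((1 - M.γ)⁻¹ * C) :=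
    (hasSum_geometric_of_lt_one M.γ_pos.le hγ).mul_right C
  rw [← (M.hasSum_integral_discountedStateDistribution π hγ p hu hC).tsum_eq]
  refine tsum_of_norm_bounded (f := fun t => M.γ ^ t * ∫ s, u s ∂(M.stateLaw π p t)) h
    fun t => ?_
  rw [Real.norm_eq_abs, abs_mul, abs_of_nonneg (pow_nonneg M.γ_pos.le t)]
  exact mul_le_mul_of_nonneg_left (abs_integral_le_of_abs_le hC) (pow_nonneg M.γ_pos.le t)

/-- The gain of choosing the first action according to `π'` rather than `π`, when `π'` is
followed afterwards. -/
noncomputable def policyAdvantage (π' : Kernel S A) [IsMarkovKernel π'] (s : S) : ℝ :=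
  ∫ a, M.actionValue π' s a ∂(π' s) - ∫ a, M.actionValue π' s a ∂(π s)

variable (π' : Kernel S A) [IsMarkovKernel π']

theorem measurable_integral_actionValue (hγ : M.γ < 1) (hb : ∀ s a, |M.R s a| ≤ b) :
    Measurable fun s => ∫ a, M.actionValue π' s a ∂(π s) :=
  ((M.measurable_actionValue π' hγ hb).stronglyMeasurable.integral_kernel_prod_right'
    (κ := π)).measurable

theorem measurable_policyAdvantage (hγ : M.γ < 1) (hb : ∀ s a, |M.R s a| ≤ b) :
    Measurable (M.policyAdvantage π π') :=
  (M.measurable_integral_actionValue π' π' hγ hb).sub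
    (M.measurable_integral_actionValue π π' hγ hb)

theorem integrable_actionValue (hγ : M.γ < 1) (hb : ∀ s a, |M.R s a| ≤ b) (s : S)
    (μ : Measure A) [IsFiniteMeasure μ] : Integrable (M.actionValue π s) μ :=
  integrable_of_measurable_of_abs_le (M.measurable_actionValue_right π hγ hb s)
    (M.abs_actionValue_le π hγ hb s)

/-- The performance difference identity. -/
theorem performance_sub_performance (hγ : M.γ < 1) (hb : ∀ s a, |M.R s a| ≤ b) (p : Measure S)
    [IsProbabilityMeasure p] :
    M.performance p π' - M.performance p π
      = ∫ s, M.policyAdvantage π π' s ∂(M.discountedStateDistribution p π) := by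
  set C := (1 - M.γ)⁻¹ * b
  set u : S → ℝ := fun s => M.value π' s - M.value π s
  have hum : Measurable u := (M.measurable_value π' hγ hb).sub (M.measurable_value π hγ hb)
  have huC (s : S) : |u s| ≤ C + C :=
    (abs_sub _ _).trans (add_le_add (M.abs_value_le π' hγ hb s) (M.abs_value_le π hγ hb s))
  have hAC (s : S) : |M.policyAdvantage π π' s| ≤ C + C :=
    (abs_sub _ _).trans (add_le_add
      (abs_integral_le_of_abs_le (M.abs_actionValue_le π' hγ hb s))
      (abs_integral_le_of_abs_le (M.abs_actionValue_le π' hγ hb s)))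
  have hτm : Measurable fun p : S × A => ∫ s', u s' ∂(M.τ p) :=
    (hum.stronglyMeasurable.integral_kernel (κ := M.τ)).measurable
  have hτC (p : S × A) : |∫ s', u s' ∂(M.τ p)| ≤ C + C := abs_integral_le_of_abs_le huC
  have hPm : Measurable fun s => ∫ a, ∫ s', u s' ∂(M.τ (s, a)) ∂(π s) :=
    (hτm.stronglyMeasurable.integral_kernel_prod_right' (κ := π)).measurable
  have hPC (s : S) : |∫ a, ∫ s', u s' ∂(M.τ (s, a)) ∂(π s)| ≤ C + C :=
    abs_integral_le_of_abs_le fun a => hτC (s, a)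
  -- Rewards cancel in the two Bellman equations, so the advantage is `u - γ P u` with `P` the state
  -- transition operator of `π`.
  have hA (s : S) : M.policyAdvantage π π' s
      = u s - M.γ * ∫ a, ∫ s', u s' ∂(M.τ (s, a)) ∂(π s) := by
    have h1 : ∫ a, M.actionValue π' s a ∂(π s) - ∫ a, M.actionValue π s a ∂(π s)
        = M.γ * ∫ a, ∫ s', u s' ∂(M.τ (s, a)) ∂(π s) := by
      rw [← integral_sub (M.integrable_actionValue π' hγ hb s _)
        (M.integrable_actionValue π hγ hb s _), ← integral_const_mul]
      congr with a
      rw [actionValue_eq M π' hγ hb, actionValue_eq M π hγ hb,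
        integral_sub (M.integrable_value π' hγ hb _) (M.integrable_value π hγ hb _)]
      ring
    rw [policyAdvantage, ← h1, ← value_eq_integral_actionValue M π' hγ hb,
      ← value_eq_integral_actionValue M π hγ hb]
    ring
  have hstep (t : ℕ) : ∫ s, M.policyAdvantage π π' s ∂(M.stateLaw π p t)
      = ∫ s, u s ∂(M.stateLaw π p t) - M.γ * ∫ s, u s ∂(M.stateLaw π p (t + 1)) := by
    simp_rw [hA]
    rw [integral_sub (integrable_of_measurable_of_abs_le hum huC)
      ((integrable_of_measurable_of_abs_le hPm hPC).const_mul _), integral_const_mul,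
      stateLaw, Measure.integral_comp_kernel (integrable_of_measurable_of_abs_le hum huC),
      Measure.integral_compProd (integrable_of_measurable_of_abs_le hτm hτC)]
  have hs := M.hasSum_integral_discountedStateDistribution π hγ p
    (M.measurable_policyAdvantage π π' hγ hb) hAC
  -- Subtracting the shifted series from this one telescopes to its term at time 0, the integral of
  -- `u` against `p`.
  have hu := M.hasSum_integral_discountedStateDistribution π hγ p hum huC
  have hu' := (hasSum_nat_add_iff' 1).2 hu
  have hs' := hs.unique (by
    convert! hu.sub hu' using 2 with t
    rw [hstep]
    ring)
  rw [hs']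
  simp only [stateLaw, Finset.range_one, Finset.sum_singleton, pow_zero, one_mul, sub_sub_cancel]
  rw [performance, performance, integral_sub (M.integrable_value π' hγ hb p)
    (M.integrable_value π hγ hb p)]

theorem performance_dirac (hγ : M.γ < 1) (hb : ∀ s a, |M.R s a| ≤ b) (s : S) :
    M.performance (Measure.dirac s) π = M.value π s :=
  integral_dirac' _ _ (M.measurable_value π hγ hb).stronglyMeasurable

/-- If the advantage of `π'` over `π` is uniformly small, their action values are close. -/
theorem abs_actionValue_sub_le (hγ : M.γ < 1) (hb : ∀ s a, |M.R s a| ≤ b) {δ : ℝ}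
    (hδ : ∀ s, |M.policyAdvantage π π' s| ≤ δ) (s : S) (a : A) :
    |M.actionValue π' s a - M.actionValue π s a| ≤ (1 - M.γ)⁻¹ * δ := by
  -- A value is a performance started from a Dirac mass, and the discounted state distribution has
  -- total mass `(1 - γ)⁻¹`.
  have hV (s : S) : |M.value π' s - M.value π s| ≤ (1 - M.γ)⁻¹ * δ := by
    rw [← performance_dirac M π' hγ hb, ← performance_dirac M π hγ hb,
      performance_sub_performance M π π' hγ hb]
    exact M.abs_integral_discountedStateDistribution_le π hγ _
      (M.measurable_policyAdvantage π π' hγ hb) hδ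
  rw [actionValue_eq M π' hγ hb, actionValue_eq M π hγ hb, add_sub_add_left_eq_sub, ← mul_sub,
    ← integral_sub (M.integrable_value π' hγ hb _) (M.integrable_value π hγ hb _), abs_mul,
    abs_of_pos M.γ_pos]
  have h := abs_integral_le_of_abs_le (μ := M.τ (s, a)) hV
  nlinarith [abs_nonneg (∫ x, (M.value π' x - M.value π x) ∂(M.τ (s, a))), M.γ_pos]

end ContinuousMDP

/-! ### Lifted policies along a homomorphism -/

namespace ContinuousMDPHom

variable {S A S' A' : Type*} [MeasurableSpace S] [MeasurableSpace A]
  [MeasurableSpace S'] [MeasurableSpace A'] {M : ContinuousMDP S A} {N : ContinuousMDP S' A'}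
  {b : ℝ}

/-- This is where surjectivity of `f` and `g_s` enters: every abstract pair is an image, so the
reward bound transfers. -/
theorem abs_reward_le (h : ContinuousMDPHom M N) (hb : ∀ s a, |M.R s a| ≤ b) (s : S') (a : A') :
    |N.R s a| ≤ b := by
  obtain ⟨s, rfl⟩ := h.surjective_f s
  obtain ⟨a, rfl⟩ := h.surjective_g s a
  rw [h.reward_eq]
  exact hb s a

theorem transition_eq_map (h : ContinuousMDPHom M N) (s : S) (a : A) : N.τ (h.f s, h.g s a) = (M.τ (s, a)).map h.f := by
  ext B hB
  rw [h.transition_eq s a B hB, Measure.map_apply h.measurable_f hB]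

theorem IsLift.map_eq {h : ContinuousMDPHom M N} {πup : Kernel S A} {πbar : Kernel S' A'}
    (hl : h.IsLift πup πbar) (s : S) : πbar (h.f s) = (πup s).map (h.g s) := by
  ext B hB
  rw [Measure.map_apply (h.measurable_g s) hB, hl s B hB]

variable {πup : Kernel S A} [IsMarkovKernel πup] {πbar : Kernel S' A'} [IsMarkovKernel πbar]

/-- Lifted policies have the same value. -/
theorem IsLift.value_eq {h : ContinuousMDPHom M N} (hl : h.IsLift πup πbar) (hγ : M.γ < 1)
    (hb : ∀ s a, |M.R s a| ≤ b) (s : S) : M.value πup s = N.value πbar (h.f s) := by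
  have hγ' : N.γ < 1 := h.discount_eq ▸ hγ
  have hb' := h.abs_reward_le hb
  have hVf : Measurable fun s => N.value πbar (h.f s) :=
    (N.measurable_value πbar hγ' hb').comp h.measurable_f
  have hVfi (μ : Measure S) [IsProbabilityMeasure μ] :
      Integrable (fun s => N.value πbar (h.f s)) μ :=
    integrable_of_measurable_of_abs_le hVf fun s => N.abs_value_le πbar hγ' hb' (h.f s)
  -- Invariance of the reward removes it from the difference, and equivariance turns the abstract
  -- transition into an integral over `M.τ`.
  have key (s : S) : M.value πup s - N.value πbar (h.f s)
      = ∫ a, M.γ * ∫ s', (M.value πup s' - N.value πbar (h.f s')) ∂(M.τ (s, a)) ∂(πup s) := by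
    rw [M.value_eq_integral_actionValue πup hγ hb, N.value_eq_integral_actionValue πbar hγ' hb',
      hl.map_eq s, integral_map (h.measurable_g s).aemeasurable
        (N.measurable_actionValue_right πbar hγ' hb' _).aestronglyMeasurable,
      ← integral_sub (M.integrable_actionValue πup hγ hb s _)
        (integrable_of_measurable_of_abs_le (f := fun a => N.actionValue πbar (h.f s) (h.g s a))
          ((N.measurable_actionValue_right πbar hγ' hb' _).comp (h.measurable_g s))
          fun a => N.abs_actionValue_le πbar hγ' hb' _ _)]
    congr with a
    rw [M.actionValue_eq πup hγ hb, N.actionValue_eq πbar hγ' hb', h.reward_eq, h.discount_eq,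
      h.transition_eq_map, integral_map h.measurable_f.aemeasurable
        (N.measurable_value πbar hγ' hb').aestronglyMeasurable,
      integral_sub (M.integrable_value πup hγ hb _) (hVfi _)]
    ring
  set C := (1 - M.γ)⁻¹ * b
  -- Iterating `key` from the a priori bound `C + C` gains a factor `γ` each time.
  have hle (n : ℕ) : ∀ s, |M.value πup s - N.value πbar (h.f s)| ≤ M.γ ^ n * (C + C) := by
    induction n with
    | zero =>
      intro s
      have h2 := N.abs_value_le πbar hγ' hb' (h.f s)
      rw [h.discount_eq] at h2
      simpa using (abs_sub _ _).trans (add_le_add (M.abs_value_le πup hγ hb s) h2)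
    | succ n ih =>
      intro s
      rw [key]
      refine abs_integral_le_of_abs_le fun a => ?_
      rw [abs_mul, abs_of_pos M.γ_pos, pow_succ', mul_assoc]
      exact mul_le_mul_of_nonneg_left (abs_integral_le_of_abs_le ih) M.γ_pos.le
  have hlim : Filter.Tendsto (fun n : ℕ => M.γ ^ n * (C + C)) Filter.atTop (𝓝 0) := by
    simpa using (tendsto_pow_atTop_nhds_zero_of_lt_one M.γ_pos.le hγ).mul_const (C + C)
  have := ge_of_tendsto' hlim fun n => hle n s
  exact sub_eq_zero.1 (abs_nonpos_iff.1 this)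

theorem IsLift.performance_eq {h : ContinuousMDPHom M N} (hl : h.IsLift πup πbar) (hγ : M.γ < 1)
    (hb : ∀ s a, |M.R s a| ≤ b) (p : Measure S) :
    M.performance p πup = N.performance (p.map h.f) πbar := by
  have hγ' : N.γ < 1 := h.discount_eq ▸ hγ
  rw [ContinuousMDP.performance, ContinuousMDP.performance, integral_map h.measurable_f.aemeasurable
    (N.measurable_value πbar hγ' (h.abs_reward_le hb)).aestronglyMeasurable]
  simp_rw [hl.value_eq hγ hb]

end ContinuousMDPHom

/-! ### Differentiating integrals against parametrized measures -/

/-- Layer-cake formula for `f + C`, which takes values in `[0, 2C]`: the superlevel sets have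
measures within `ε`, and the interval of levels has length `2C`. -/
theorem MeasureTheory.abs_integral_sub_integral_le {X : Type*} [MeasurableSpace X]
    {μ ν : Measure X} [IsProbabilityMeasure μ] [IsProbabilityMeasure ν] {ε : ℝ}
    (hε : ∀ B, MeasurableSet B → |μ.real B - ν.real B| ≤ ε) {f : X → ℝ} (hf : Measurable f) {C : ℝ}
    (hC : ∀ x, |f x| ≤ C) : |∫ x, f x ∂μ - ∫ x, f x ∂ν| ≤ 2 * C * ε := by
  obtain ⟨x₀⟩ := nonempty_of_isProbabilityMeasure μ
  have hC0 : 0 ≤ C := (abs_nonneg _).trans (hC x₀)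
  have h0 (x : X) : 0 ≤ f x + C := by linarith [(abs_le.1 (hC x)).1]
  have h1 (x : X) : f x + C ≤ 2 * C := by linarith [(abs_le.1 (hC x)).2]
  have hInt (ρ : Measure X) [IsProbabilityMeasure ρ] : Integrable f ρ :=
    integrable_of_measurable_of_abs_le hf hC
  have hcake (ρ : Measure X) [IsProbabilityMeasure ρ] :
      ∫ x, f x ∂ρ = (∫ t in Set.Ioc 0 (2 * C), ρ.real {x | t ≤ f x + C}) - C := by
    have h := ((hInt ρ).add (integrable_const C)).integral_eq_integral_Ioc_meas_le (M := 2 * C)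
      (ae_of_all _ h0) (ae_of_all _ h1)
    simp only [Pi.add_apply] at h
    rw [← h, integral_add (hInt ρ) (integrable_const C)]
    simp
  have hanti (ρ : Measure X) [IsProbabilityMeasure ρ] :
      IntegrableOn (fun t => ρ.real {x | t ≤ f x + C}) (Set.Ioc 0 (2 * C)) := by
    have : Antitone fun t => ρ.real {x | t ≤ f x + C} := fun s t hst =>
      measureReal_mono fun x (hx : t ≤ f x + C) => hst.trans hx
    exact integrable_of_measurable_of_abs_le this.measurable (C := 1) fun t => by
      rw [abs_of_nonneg measureReal_nonneg]; exact measureReal_le_one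
  rw [hcake μ, hcake ν, sub_sub_sub_cancel_right, ← integral_sub (hanti μ) (hanti ν)]
  have h := norm_setIntegral_le_of_norm_le_const (μ := volume) (s := Set.Ioc 0 (2 * C)) (C := ε)
    (f := fun t => μ.real {x | t ≤ f x + C} - ν.real {x | t ≤ f x + C}) measure_Ioc_lt_top
    (fun t _ => hε _ (measurableSet_le measurable_const (hf.add_const C)))
  rw [Real.norm_eq_abs] at h
  refine h.trans_eq ?_
  rw [Real.volume_real_Ioc_of_le (by linarith)]
  ring

/-- Round `f` down to multiples of `ε`; boundedness leaves finitely many values. Uniform closeness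
is needed because one `φ` must serve all nearby measures at once. -/
theorem MeasureTheory.SimpleFunc.exists_abs_sub_le {X : Type*} [MeasurableSpace X] {f : X → ℝ}
    (hf : Measurable f) {C : ℝ} (hC : ∀ x, |f x| ≤ C) {ε : ℝ} (hε : 0 < ε) :
    ∃ φ : SimpleFunc X ℝ, ∀ x, |f x - φ x| ≤ ε := by
  have hm : Measurable fun x => ε * (⌊f x / ε⌋ : ℝ) :=
    ((measurable_from_top (f := fun k : ℤ => (k : ℝ))).comp (hf.div_const ε).floor).const_mul ε
  refine ⟨⟨fun x => ε * ⌊f x / ε⌋, fun y => hm (measurableSet_singleton y), ?_⟩, fun x => ?_⟩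
  · refine ((Set.finite_Icc ⌊-C / ε⌋ ⌊C / ε⌋).image fun k : ℤ => ε * (k : ℝ)).subset ?_
    rintro _ ⟨x, rfl⟩
    refine ⟨⌊f x / ε⌋, ⟨Int.floor_le_floor ?_, Int.floor_le_floor ?_⟩, rfl⟩
    · exact div_le_div_of_nonneg_right (abs_le.1 (hC x)).1 hε.le
    · exact div_le_div_of_nonneg_right (abs_le.1 (hC x)).2 hε.le
  · change |f x - ε * ⌊f x / ε⌋| ≤ ε
    have h : f x = ε * (f x / ε) := by field_simp
    have h1 := Int.floor_le (f x / ε)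
    have h2 := Int.lt_floor_add_one (f x / ε)
    rw [abs_le]
    constructor <;> nlinarith

/-- The coordinates are signed measures, of finite variation, and finitely many of them dominate
`D`. -/
theorem MeasureTheory.VectorMeasure.isFiniteMeasure_variation {X ι : Type*} [MeasurableSpace X]
    [Fintype ι] (D : VectorMeasure X (EuclideanSpace ℝ ι)) : IsFiniteMeasure D.variation := by
  let c (i : ι) : SignedMeasure X :=
    D.mapRange (EuclideanSpace.proj (𝕜 := ℝ) i : EuclideanSpace ℝ ι →L[ℝ] ℝ).toAddMonoidHom
      (EuclideanSpace.proj (𝕜 := ℝ) i).continuous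
  have hc (i : ι) : IsFiniteMeasure (c i).variation := by
    rw [← SignedMeasure.totalVariation_eq_variation]; infer_instance
  have hle : D.variation ≤ ∑ i, (c i).variation := by
    refine VectorMeasure.variation_le_of_forall_enorm_le fun B hB => ?_
    classical
    have h1 : D B = ∑ i, EuclideanSpace.single i (D B i) := by
      ext j
      simp [Finset.sum_apply]
    rw [h1]
    refine (enorm_sum_le _ _).trans ?_
    rw [Measure.finsetSum_apply]
    refine Finset.sum_le_sum fun i _ => ?_
    have h2 : ‖EuclideanSpace.single i (D B i)‖ₑ = ‖c i B‖ₑ := by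
      rw [← ofReal_norm, ← ofReal_norm, PiLp.norm_single]
      rfl
    rw [h2]
    exact VectorMeasure.enorm_measure_le_variation _ _
  exact isFiniteMeasure_of_le _ hle

section Gradient

variable {X Θ : Type*} [MeasurableSpace X] [NormedAddCommGroup Θ] [InnerProductSpace ℝ Θ]
  [CompleteSpace Θ] {μ : Θ → Measure X} [∀ θ, IsProbabilityMeasure (μ θ)] {θ : Θ}
  {D : VectorMeasure X Θ} [IsFiniteMeasure D.variation]

theorem hasGradientAt_integral_simpleFunc
    (hD : ∀ B, MeasurableSet B → HasGradientAt (fun ϑ => (μ ϑ).real B) (D B) θ)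
    (φ : SimpleFunc X ℝ) :
    HasGradientAt (fun ϑ => ∫ x, φ x ∂(μ ϑ)) (D.integral φ (ContinuousLinearMap.lsmul ℝ ℝ)) θ := by
  have h1 : (fun ϑ => ∫ x, φ x ∂(μ ϑ)) =
      fun ϑ => ∑ y ∈ φ.range, y * (μ ϑ).real (φ ⁻¹' {y}) := by
    ext ϑ
    rw [← SimpleFunc.integral_eq_integral _ φ.integrable_of_isFiniteMeasure, SimpleFunc.integral_eq]
    simp [mul_comm]
  have h2 : D.integral φ (ContinuousLinearMap.lsmul ℝ ℝ) = ∑ y ∈ φ.range, y • D (φ ⁻¹' {y}) := by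
    rw [VectorMeasure.integral_eq_setToFun,
      setToFun_simpleFunc _ _ φ.integrable_of_isFiniteMeasure]
    rfl
  rw [h1, h2, hasGradientAt_iff_hasFDerivAt, map_sum]
  refine HasFDerivAt.fun_sum fun y _ => ?_
  rw [map_smul]
  exact (hD _ (φ.measurableSet_fiber y)).hasFDerivAt.const_mul y

/-- Approximate `f` by a simple `φ`. The increment of the integral of `f - φ` is small relative to
`‖ϑ - θ‖` by the Lipschitz bound `hK`, and its would-be gradient is small by finite variation. -/
theorem hasGradientAt_integral_of_bounded
    (hD : ∀ B, MeasurableSet B → HasGradientAt (fun ϑ => (μ ϑ).real B) (D B) θ) {K : ℝ}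
    (hK : ∀ᶠ ϑ in 𝓝 θ, ∀ B, MeasurableSet B → |(μ ϑ).real B - (μ θ).real B| ≤ K * ‖ϑ - θ‖)
    {f : X → ℝ} (hf : Measurable f) {C : ℝ} (hC : ∀ x, |f x| ≤ C) :
    HasGradientAt (fun ϑ => ∫ x, f x ∂(μ ϑ)) (D.integral f (ContinuousLinearMap.lsmul ℝ ℝ)) θ := by
  rw [hasGradientAt_iff_hasFDerivAt, hasFDerivAt_iff_isLittleO, Asymptotics.isLittleO_iff]
  intro c hc
  set V := D.variation.real Set.univ
  have hV : 0 ≤ V := measureReal_nonneg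
  -- Chosen so that the approximation costs at most `c / 2`; the other half goes to the remainder of
  -- `φ`.
  set ε := c / (2 * (2 * |K| + V + 1))
  have hden : 0 < 2 * (2 * |K| + V + 1) := by positivity
  have hε : 0 < ε := div_pos hc hden
  have hεc : 2 * ε * |K| + ε * V ≤ c / 2 := by
    have : ε * (2 * (2 * |K| + V + 1)) = c := div_mul_cancel₀ c hden.ne'
    linarith
  obtain ⟨φ, hφ⟩ := SimpleFunc.exists_abs_sub_le hf hC hε
  have hφD := (hasGradientAt_integral_simpleFunc hD φ).hasFDerivAt
  rw [hasFDerivAt_iff_isLittleO, Asymptotics.isLittleO_iff] at hφD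
  have hfφ : Measurable fun x => f x - φ x := hf.sub φ.measurable
  have hfi (ν : Measure X) [IsFiniteMeasure ν] : Integrable f ν :=
    integrable_of_measurable_of_abs_le hf hC
  have hGφ : ‖D.integral f (ContinuousLinearMap.lsmul ℝ ℝ)
      - D.integral φ (ContinuousLinearMap.lsmul ℝ ℝ)‖ ≤ ε * V := by
    rw [← VectorMeasure.integral_fun_sub (hfi _) φ.integrable_of_isFiniteMeasure]
    refine (VectorMeasure.norm_integral_le_integral_norm).trans ?_
    have h1 : ∫ x, ‖f x - φ x‖ ∂D.variation ≤ ∫ _, ε ∂D.variation :=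
      integral_mono (((hfi _).sub φ.integrable_of_isFiniteMeasure).norm) (integrable_const _) hφ
    have h2 : ‖(ContinuousLinearMap.lsmul ℝ ℝ : ℝ →L[ℝ] Θ →L[ℝ] Θ)‖ ≤ 1 :=
      ContinuousLinearMap.opNorm_lsmul_le
    have h3 : 0 ≤ ∫ x, ‖f x - φ x‖ ∂D.variation := integral_nonneg fun _ => norm_nonneg _
    rw [integral_const, smul_eq_mul, mul_comm] at h1
    calc _ ≤ 1 * ∫ x, ‖f x - φ x‖ ∂D.variation := mul_le_mul_of_nonneg_right h2 h3
      _ ≤ ε * V := by rwa [one_mul]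
  filter_upwards [hK, hφD (half_pos hc)] with ϑ hϑ hϑφ
  have hKϑ : ∀ B, MeasurableSet B → |(μ ϑ).real B - (μ θ).real B| ≤ |K| * ‖ϑ - θ‖ :=
    fun B hB => (hϑ B hB).trans (mul_le_mul_of_nonneg_right (le_abs_self K) (norm_nonneg _))
  have h1 := abs_integral_sub_integral_le hKϑ hfφ hφ
  rw [integral_sub (hfi _) φ.integrable_of_isFiniteMeasure,
    integral_sub (hfi _) φ.integrable_of_isFiniteMeasure] at h1
  have h2 := abs_real_inner_le_norm (D.integral f (ContinuousLinearMap.lsmul ℝ ℝ)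
      - D.integral φ (ContinuousLinearMap.lsmul ℝ ℝ)) (ϑ - θ)
  have h3 := mul_le_mul_of_nonneg_right hGφ (norm_nonneg (ϑ - θ))
  rw [inner_sub_left] at h2
  rw [Real.norm_eq_abs, InnerProductSpace.toDual_apply_apply] at hϑφ ⊢
  have h4 := mul_le_mul_of_nonneg_right hεc (norm_nonneg (ϑ - θ))
  rw [abs_le] at h1 h2 hϑφ ⊢
  constructor <;> nlinarith

end Gradient

/-- Differentiation under the integral sign, for gradients with respect to a parameter in a
Euclidean space; the measurability of the gradient is automatic. -/
theorem hasGradientAt_integral_of_lip {S ι : Type*} [MeasurableSpace S] [Fintype ι]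
    {ρ : Measure S} [IsFiniteMeasure ρ] {g : EuclideanSpace ℝ ι → S → ℝ}
    {G : S → EuclideanSpace ℝ ι} {θ : EuclideanSpace ℝ ι} (hg : ∀ ϑ, Measurable (g ϑ))
    (hgi : Integrable (g θ) ρ) (hG : ∀ s, HasGradientAt (fun ϑ => g ϑ s) (G s) θ) {K : ℝ}
    (hK : ∀ᶠ ϑ in 𝓝 θ, ∀ s, |g ϑ s - g θ s| ≤ K * ‖ϑ - θ‖) :
    Integrable G ρ ∧ HasGradientAt (fun ϑ => ∫ s, g ϑ s ∂ρ) (∫ s, G s ∂ρ) θ := by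
  classical
  have hGm : Measurable G := by
    suffices h : Measurable fun s => (MeasurableEquiv.toLp 2 (ι → ℝ)).symm (G s) by
      exact (MeasurableEquiv.toLp 2 (ι → ℝ)).measurable.comp h
    refine measurable_pi_iff.2 fun i => ?_
    -- Each coordinate of `G` is a sequential limit of measurable difference quotients with step `1
    -- / k`.
    have hlim (s : S) := ((hG s).hasFDerivAt.lim_real (EuclideanSpace.single i 1)).comp
      tendsto_natCast_atTop_atTop
    refine measurable_of_tendsto_metrizable (f := fun (k : ℕ) s =>
      (k : ℝ) • (g (θ + (k : ℝ)⁻¹ • EuclideanSpace.single i 1) s - g θ s))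
      (fun k => ((hg _).sub (hg θ)).const_mul _) (tendsto_pi_nhds.2 fun s => ?_)
    convert! hlim s using 2
    simp [InnerProductSpace.toDual_apply_apply, EuclideanSpace.inner_single_right]
  have hF'm : AEStronglyMeasurable (fun s => InnerProductSpace.toDual ℝ _ (G s)) ρ :=
    ((InnerProductSpace.toDual ℝ (EuclideanSpace ℝ ι)).continuous.measurable.comp
      hGm).aestronglyMeasurable
  obtain ⟨hInt, hder⟩ := hasFDerivAt_integral_of_dominated_loc_of_lip' (μ := ρ) (F := g)
    (bound := fun _ => K) (x₀ := θ) hK (fun ϑ _ => (hg ϑ).aestronglyMeasurable) hgi hF'm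
    (ae_of_all _ fun s ϑ hϑ => hϑ s) (integrable_const K)
    (ae_of_all _ fun s => (hG s).hasFDerivAt)
  have hGi : Integrable G ρ := by
    refine hInt.norm.mono' hGm.aestronglyMeasurable (ae_of_all _ fun s => ?_)
    rw [LinearIsometryEquiv.norm_map]
  refine ⟨hGi, ?_⟩
  rw [hasGradientAt_iff_hasFDerivAt]
  convert! hder using 1
  ext v
  rw [InnerProductSpace.toDual_apply_apply, ContinuousLinearMap.integral_apply hInt,
    real_inner_comm, ← integral_inner hGi]
  simp_rw [InnerProductSpace.toDual_apply_apply, real_inner_comm]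

/-- A policy with a locally bounded gradient is Lipschitz at each parameter, uniformly in the state
and the event. -/
theorem exists_lipschitz_policy {S A Θ : Type*} [MeasurableSpace S] [MeasurableSpace A]
    [NormedAddCommGroup Θ] [InnerProductSpace ℝ Θ] [CompleteSpace Θ] {U : Set Θ} (hU : IsOpen U)
    {π : Θ → Kernel S A} (hdiff : ∀ θ ∈ U, PolicyDifferentiableAt π θ) {θ : Θ} (hθ : θ ∈ U)
    (hbound : ∃ L : ℝ, ∀ᶠ ϑ in 𝓝 θ, ∀ (s : S) (B : Set A), MeasurableSet B →
      ‖policyGradient π ϑ s B‖ ≤ L) :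
    ∃ L : ℝ, ∀ᶠ ϑ in 𝓝 θ, ∀ (s : S) (B : Set A), MeasurableSet B →
      |(π ϑ s).real B - (π θ s).real B| ≤ L * ‖ϑ - θ‖ := by
  obtain ⟨L, hL⟩ := hbound
  -- A ball, because the mean value inequality needs a convex set; it lies in `U`, so gradients
  -- exist throughout.
  obtain ⟨r, hr, hball⟩ := Metric.mem_nhds_iff.1 (hL.and (hU.mem_nhds hθ))
  refine ⟨L, Filter.mem_of_superset (Metric.ball_mem_nhds θ hr) fun ϑ hϑ s B hB => ?_⟩
  refine (convex_ball θ r).norm_image_sub_le_of_norm_hasFDerivWithin_le (𝕜 := ℝ)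
    (f := fun ϑ => (π ϑ s).real B)
    (f' := fun ϑ => InnerProductSpace.toDual ℝ Θ (policyGradient π ϑ s B))
    (fun x hx => ?_) (fun x hx => ?_) (Metric.mem_ball_self hr) hϑ
  · obtain ⟨D, hD⟩ := hdiff x (hball hx).2 s
    rw [hD.policyGradient_eq]
    exact (hD B hB).hasFDerivAt.hasFDerivWithinAt
  · rw [LinearIsometryEquiv.norm_map]
    exact (hball hx).1 s B hB

/-! ### The policy gradient theorem and its transfer to lifts -/

/-- The stochastic policy gradient theorem. -/
theorem ContinuousMDP.hasGradientAt_performance {S A ι : Type*} [MeasurableSpace S]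
    [MeasurableSpace A] [Fintype ι] (M : ContinuousMDP S A) {b : ℝ} (hγ : M.γ < 1)
    (hb : ∀ s a, |M.R s a| ≤ b) (p : Measure S) [IsProbabilityMeasure p]
    (π : EuclideanSpace ℝ ι → Kernel S A) [∀ θ, IsMarkovKernel (π θ)] {θ : EuclideanSpace ℝ ι}
    (hdiff : PolicyDifferentiableAt π θ) {K : ℝ}
    (hK : ∀ᶠ ϑ in 𝓝 θ, ∀ (s : S) (B : Set A), MeasurableSet B →
      |(π ϑ s).real B - (π θ s).real B| ≤ K * ‖ϑ - θ‖) :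
    Integrable
      (fun s => (policyGradient π θ s).integral (M.actionValue (π θ) s)
        (ContinuousLinearMap.lsmul ℝ ℝ)) (M.discountedStateDistribution p (π θ)) ∧
    HasGradientAt (fun ϑ => M.performance p (π ϑ))
      (∫ s, (policyGradient π θ s).integral (M.actionValue (π θ) s)
        (ContinuousLinearMap.lsmul ℝ ℝ) ∂(M.discountedStateDistribution p (π θ))) θ := by
  set ρ := M.discountedStateDistribution p (π θ)
  have hρ : IsFiniteMeasure ρ := M.isFiniteMeasure_discountedStateDistribution (π θ) hγ p
  set C := (1 - M.γ)⁻¹ * b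
  have hQC (ϑ) (s : S) (a : A) : |M.actionValue (π ϑ) s a| ≤ C := M.abs_actionValue_le _ hγ hb s a
  -- The action value stays frozen at `θ`; only the policy moves.
  let g (ϑ : EuclideanSpace ℝ ι) (s : S) : ℝ := ∫ a, M.actionValue (π θ) s a ∂(π ϑ s)
  have hgm (ϑ) : Measurable (g ϑ) := M.measurable_integral_actionValue (π ϑ) (π θ) hγ hb
  have hgC (ϑ) (s : S) : |g ϑ s| ≤ C := abs_integral_le_of_abs_le (hQC θ s)
  have hgi (ϑ) : Integrable (g ϑ) ρ := integrable_of_measurable_of_abs_le (hgm ϑ) (hgC ϑ)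
  have hgrad (s : S) : HasGradientAt (fun ϑ => g ϑ s)
      ((policyGradient π θ s).integral (M.actionValue (π θ) s)
        (ContinuousLinearMap.lsmul ℝ ℝ)) θ := by
    obtain ⟨D, hD⟩ := hdiff s
    rw [hD.policyGradient_eq]
    have := D.isFiniteMeasure_variation
    exact hasGradientAt_integral_of_bounded (μ := fun ϑ => π ϑ s) hD (hK.mono fun ϑ h => h s)
      (M.measurable_actionValue_right (π θ) hγ hb s) (hQC θ s)
  have hglip : ∀ᶠ ϑ in 𝓝 θ, ∀ s, |g ϑ s - g θ s| ≤ (2 * C * K) * ‖ϑ - θ‖ := by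
    filter_upwards [hK] with ϑ h s
    rw [mul_assoc]
    exact abs_integral_sub_integral_le (h s) (M.measurable_actionValue_right (π θ) hγ hb s)
      (hQC θ s)
  obtain ⟨hInt, hder⟩ := hasGradientAt_integral_of_lip (ρ := ρ) hgm (hgi θ) hgrad hglip
  refine ⟨hInt, ?_⟩
  -- The error of freezing: `Q^ϑ - Q^θ` integrated against `π_ϑ - π_θ`, as `heq` shows.
  let e (ϑ : EuclideanSpace ℝ ι) (s : S) : ℝ :=
    M.policyAdvantage (π θ) (π ϑ) s - (g ϑ s - g θ s)
  have hem (ϑ) : Measurable (e ϑ) :=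
    (M.measurable_policyAdvantage (π θ) (π ϑ) hγ hb).sub ((hgm ϑ).sub (hgm θ))
  have hO : (fun ϑ => ∫ s, e ϑ s ∂ρ) =O[𝓝 θ] fun ϑ => ‖ϑ - θ‖ ^ 2 := by
    refine Asymptotics.IsBigO.of_bound
      ((1 - M.γ)⁻¹ * (2 * ((1 - M.γ)⁻¹ * (2 * C * K)) * K)) ?_
    filter_upwards [hK] with ϑ h
    -- A first-order advantage makes the action values first-order close; integrating their
    -- difference against `π_ϑ - π_θ` gives the second factor.
    have hadv (s : S) : |M.policyAdvantage (π θ) (π ϑ) s| ≤ 2 * C * (K * ‖ϑ - θ‖) :=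
      abs_integral_sub_integral_le (h s) (M.measurable_actionValue_right (π ϑ) hγ hb s) (hQC ϑ s)
    have he (s : S) : |e ϑ s|
        ≤ 2 * ((1 - M.γ)⁻¹ * (2 * C * (K * ‖ϑ - θ‖))) * (K * ‖ϑ - θ‖) := by
      have heq : e ϑ s = ∫ a, (M.actionValue (π ϑ) s a - M.actionValue (π θ) s a) ∂(π ϑ s)
          - ∫ a, (M.actionValue (π ϑ) s a - M.actionValue (π θ) s a) ∂(π θ s) := by
        rw [integral_sub (M.integrable_actionValue _ hγ hb s _)
            (M.integrable_actionValue _ hγ hb s _),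
          integral_sub (M.integrable_actionValue _ hγ hb s _)
            (M.integrable_actionValue _ hγ hb s _)]
        simp only [e, g, policyAdvantage]
        ring
      rw [heq]
      exact abs_integral_sub_integral_le (h s)
        ((M.measurable_actionValue_right (π ϑ) hγ hb s).sub
          (M.measurable_actionValue_right (π θ) hγ hb s))
        (M.abs_actionValue_sub_le (π θ) (π ϑ) hγ hb hadv s)
    have hE := M.abs_integral_discountedStateDistribution_le (π θ) hγ p (hem ϑ) he
    rw [Real.norm_eq_abs, norm_pow, norm_norm]
    refine hE.trans_eq ?_
    ring
  -- A quadratic bound forces derivative zero.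
  have hE := hO.hasFDerivAt (𝕜 := ℝ) one_lt_two
  have hJ : (fun ϑ => M.performance p (π ϑ))
      = fun ϑ => (∫ s, g ϑ s ∂ρ + ∫ s, e ϑ s ∂ρ) + (M.performance p (π θ) - ∫ s, g θ s ∂ρ) := by
    ext ϑ
    have hei : Integrable (fun s => M.policyAdvantage (π θ) (π ϑ) s) ρ := by
      refine integrable_of_measurable_of_abs_le (C := C + C)
        (M.measurable_policyAdvantage (π θ) (π ϑ) hγ hb) fun s => ?_
      exact (abs_sub _ _).trans (add_le_add (abs_integral_le_of_abs_le (hQC ϑ s))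
        (abs_integral_le_of_abs_le (hQC ϑ s)))
    have h1 := M.performance_sub_performance (π θ) (π ϑ) hγ hb p
    have h2 : ∫ s, e ϑ s ∂ρ = ∫ s, M.policyAdvantage (π θ) (π ϑ) s ∂ρ
        - (∫ s, g ϑ s ∂ρ - ∫ s, g θ s ∂ρ) := by
      rw [← integral_sub (hgi ϑ) (hgi θ)]
      exact integral_sub hei ((hgi ϑ).sub (hgi θ))
    linarith
  rw [hJ, hasGradientAt_iff_hasFDerivAt]
  simpa using (hder.hasFDerivAt.add hE).add_const (M.performance p (π θ) - ∫ s, g θ s ∂ρ)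

theorem mainTheorem4 {S A S' A' : Type*} [MeasurableSpace S] [MeasurableSpace A]
    [MeasurableSpace S'] [MeasurableSpace A']
    (M : ContinuousMDP S A) (N : ContinuousMDP S' A') (h : ContinuousMDPHom M N)
    (hγ : M.γ < 1) (hR : ∃ b : ℝ, ∀ s a, |M.R s a| ≤ b)
    (p₁ : Measure S) [IsProbabilityMeasure p₁]
    {n : ℕ} (U : Set (EuclideanSpace ℝ (Fin n))) (hU : IsOpen U)
    (πbar : EuclideanSpace ℝ (Fin n) → Kernel S' A') [∀ θ, IsMarkovKernel (πbar θ)]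
    (hdiff : ∀ θ ∈ U, PolicyDifferentiableAt πbar θ)
    (hbound : ∀ θ ∈ U, ∃ L : ℝ, ∀ᶠ ϑ in 𝓝 θ, ∀ (s : S') (B : Set A'), MeasurableSet B →
      ‖policyGradient πbar ϑ s B‖ ≤ L)
    (πup : EuclideanSpace ℝ (Fin n) → Kernel S A) [∀ θ, IsMarkovKernel (πup θ)]
    (hlift : ∀ θ ∈ U, h.IsLift (πup θ) (πbar θ)) :
    ∀ θ ∈ U,
      (∀ s : S', (policyGradient πbar θ s).Integrable (N.actionValue (πbar θ) s)) ∧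
      Integrable
        (fun s => (policyGradient πbar θ s).integral (N.actionValue (πbar θ) s)
          (ContinuousLinearMap.lsmul ℝ ℝ))
        (N.discountedStateDistribution (p₁.map h.f) (πbar θ)) ∧
      HasGradientAt (fun ϑ => M.performance p₁ (πup ϑ))
        (∫ s, (policyGradient πbar θ s).integral (N.actionValue (πbar θ) s)
            (ContinuousLinearMap.lsmul ℝ ℝ)
          ∂(N.discountedStateDistribution (p₁.map h.f) (πbar θ))) θ := by
  intro θ hθ
  obtain ⟨b, hb⟩ := hR
  have hγ' : N.γ < 1 := h.discount_eq ▸ hγ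
  have hb' := h.abs_reward_le hb
  have : IsProbabilityMeasure (p₁.map h.f) :=
    Measure.isProbabilityMeasure_map h.measurable_f.aemeasurable
  obtain ⟨K, hK⟩ := exists_lipschitz_policy hU hdiff hθ (hbound θ hθ)
  obtain ⟨hInt, hgrad⟩ :=
    N.hasGradientAt_performance hγ' hb' (p₁.map h.f) πbar (hdiff θ hθ) hK
  refine ⟨fun s => ?_, hInt, ?_⟩
  · have := (policyGradient πbar θ s).isFiniteMeasure_variation
    exact N.integrable_actionValue (πbar θ) hγ' hb' s _
  · refine HasFDerivAt.congr_of_eventuallyEq hgrad ?_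
    -- The lift property is available only on `U`, so the two performances agree only near `θ`,
    -- which suffices for the derivative.
    filter_upwards [hU.mem_nhds hθ] with ϑ hϑ
    exact (hlift ϑ hϑ).performance_eq hγ hb p₁
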